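/- Let $n\ge 0$ be an integer and $\hbar>0$. Write points of $\mathbb{R}^{2n}$ as $z=(x,p)$ with $x,p\in\mathbb{R}^n$, put $J(x,p)=(p,-x)$ and $\sigma(z,z')=Jz\cdot z'=p\cdot x'-p'\cdot x$. For $z_0=(x_0,p_0)$ let $\widehat T(z_0)$ be the Heisenberg operator $$\widehat T(z_0)\psi(x)=e^{\frac{i}{\hbar}(p_0\cdot x-\frac12 p_0\cdot x_0)}\psi(x-x_0),\qquad \psi\in\mathcal S(\mathbb R^n),$$ let $$\Theta(z)=\frac{\sin(p\cdot x/2\hbar)}{p\cdot x/2\hbar}\quad(\Theta(z)=1\text{ if }p\cdot x=0),$$ and for $a\in\mathcal S'(\mathbb R^{2n})$ let $a_\sigma$ be the symplectic Fourier transform, formally $a_\sigma(z)=(2\pi\hbar)^{-n}\int_{\mathbb R^{2n}} e^{-\frac{i}{\hbar}\sigma(z,z')}a(z')\,dz'$, extended to $\mathcal S'(\mathbb R^{2n})$ in the usual way. The Born--Jordan operator with symbol $a\in\mathcal S'(\mathbb R^{2n})$ is the continuous linear operator $\operatorname{Op}_{\mathrm{BJ}}(a):\mathcal S(\mathbb R^n)\to\mathcal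 S'(\mathbb R^n)$, $$\operatorname{Op}_{\mathrm{BJ}}(a)\psi=\Big(\tfrac{1}{2\pi\hbar}\Big)^{n}\int_{\mathbb R^{2n}}a_\sigma(z)\,\Theta(z)\,\widehat T(z)\psi\,dz,$$ the integral being understood weakly: $\langle\operatorname{Op}_{\mathrm{BJ}}(a)\psi,\varphi\rangle=(2\pi\hbar)^{-n}\langle\Theta a_\sigma,\ \langle\widehat T(\cdot)\psi,\varphi\rangle\rangle$ for $\psi,\varphi\in\mathcal S(\mathbb R^n)$, with bilinear pairings. Let $\operatorname{Mp}(2n,\mathbb R)$ be the metaplectic group, that is, the group of unitary operators on $L^2(\mathbb R^n)$ generated by $$\widehat J\psi(x)=e^{-in\pi/4}(2\pi\hbar)^{-n/2}\int_{\mathbb R^n} e^{-\frac{i}{\hbar}x\cdot x'}\psi(x')\,dx',\qquad \widehat M_{L,m}\psi(x)=i^m\sqrt{|\det L|}\,\psi(Lx),\qquad \widehat V_P\psi(x)=e^{-\frac{i}{2\hbar}Px\cdot x}\psi(x),$$ where $L\in GL(n,\mathbb R)$, $m$ is an integer such that $m\pi$ is an argument of $\det L$, and $P$ is a real symmetric $n\times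 n$ matrix. These operators restrict to automorphisms of $\mathcal S(\mathbb R^n)$ and extend to automorphisms of $\mathcal S'(\mathbb R^n)$. Let $\pi^{\mathrm{Mp}}:\operatorname{Mp}(2n,\mathbb R)\to\operatorname{Sp}(2n,\mathbb R)$ be the covering projection, that is, the group homomorphism with $$\pi^{\mathrm{Mp}}(\widehat J)=J,\qquad \pi^{\mathrm{Mp}}(\widehat M_{L,m})=\begin{pmatrix}L^{-1}&0\\0&L^{T}\end{pmatrix},\qquad \pi^{\mathrm{Mp}}(\widehat V_P)=\begin{pmatrix}I&0\\-P&I\end{pmatrix}.$$ Then for every $a\in\mathcal S'(\mathbb R^{2n})$ and every $\widehat S$ in the subgroup of $\operatorname{Mp}(2n,\mathbb R)$ generated by $\widehat J$ and all the $\widehat M_{L,m}$, with $s=\pi^{\mathrm{Mp}}(\widehat S)$, $$\widehat S\,\operatorname{Op}_{\mathrm{BJ}}(a)\,\widehat S^{-1}=\operatorname{Op}_{\mathrm{BJ}}(a\circ s^{-1})$$ as operators $\mathcal S(\mathbb R^n)\to\mathcal S'(\mathbb R^n)$. -/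

import Mathlib

open MeasureTheory SchwartzMap FourierTransform
open scoped ComplexConjugate Real ContDiff InnerProductSpace Matrix

noncomputable section

namespace BornJordan

variable {n : ℕ}

/-- Configuration space `ℝⁿ`. -/
abbrev Config (n : ℕ) := EuclideanSpace ℝ (Fin n)

/-- Phase space `ℝ²ⁿ`; a point is `z = (x, p)` with `x` in the left and `p` in the right block. -/
abbrev Phase (n : ℕ) := EuclideanSpace ℝ (Fin n ⊕ Fin n)

/-- The position component `x` of `z = (x, p)`. -/
def pos : Phase n →L[ℝ] Config n :=
  LinearMap.toContinuousLinearMap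
    { toFun := fun z => WithLp.toLp 2 fun i => z (Sum.inl i)
      map_add' := fun _ _ => rfl
      map_smul' := fun _ _ => rfl }

/-- The momentum component `p` of `z = (x, p)`. -/
def mom : Phase n →L[ℝ] Config n :=
  LinearMap.toContinuousLinearMap
    { toFun := fun z => WithLp.toLp 2 fun i => z (Sum.inr i)
      map_add' := fun _ _ => rfl
      map_smul' := fun _ _ => rfl }

/-- The point `(x, p)` of phase space. -/
def phasePt (x p : Config n) : Phase n := WithLp.toLp 2 (Sum.elim x p)

@[simp] theorem pos_apply (z : Phase n) (i : Fin n) : pos z i = z (Sum.inl i) := rfl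
@[simp] theorem mom_apply (z : Phase n) (i : Fin n) : mom z i = z (Sum.inr i) := rfl
@[simp] theorem pos_phasePt (x p : Config n) : pos (phasePt x p) = x := rfl
@[simp] theorem mom_phasePt (x p : Config n) : mom (phasePt x p) = p := rfl

theorem phase_ext {z w : Phase n} (h₁ : pos z = pos w) (h₂ : mom z = mom w) : z = w := by
  ext (i | i)
  · simpa using congrArg (fun v : Config n => v i) h₁
  · simpa using congrArg (fun v : Config n => v i) h₂

theorem phase_inner (z w : Phase n) : ⟪z, w⟫_ℝ = ⟪pos z, pos w⟫_ℝ + ⟪mom z, mom w⟫_ℝ := by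
  simp [PiLp.inner_apply, Fintype.sum_sum_type]

theorem phase_norm_sq (z : Phase n) : ‖z‖ ^ 2 = ‖pos z‖ ^ 2 + ‖mom z‖ ^ 2 := by
  simp [EuclideanSpace.norm_sq_eq, Fintype.sum_sum_type]

theorem norm_pos_le (z : Phase n) : ‖pos z‖ ≤ ‖z‖ :=
  le_of_sq_le_sq (by nlinarith [phase_norm_sq z, sq_nonneg ‖mom z‖]) (norm_nonneg _)

theorem norm_mom_le (z : Phase n) : ‖mom z‖ ≤ ‖z‖ :=
  le_of_sq_le_sq (by nlinarith [phase_norm_sq z, sq_nonneg ‖pos z‖]) (norm_nonneg _)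

theorem phase_norm_le (z : Phase n) : ‖z‖ ≤ ‖pos z‖ + ‖mom z‖ :=
  le_of_sq_le_sq (by nlinarith [phase_norm_sq z, norm_nonneg (pos z), norm_nonneg (mom z)])
    (by positivity)

/-- Lebesgue measure on phase space is the product of the Lebesgue measures. -/
theorem measurePreserving_phasePt :
    ∃ e : Config n × Config n ≃ᵐ Phase n,
      MeasurePreserving e ∧ ∀ q, e q = phasePt q.1 q.2 := by
  have h1 := EuclideanSpace.volume_preserving_symm_measurableEquiv_toLp (Fin n)
  have h2 := (EuclideanSpace.volume_preserving_symm_measurableEquiv_toLp (Fin n ⊕ Fin n)).symm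
  have h3 := volume_measurePreserving_sumPiEquivProdPi_symm (fun _ : Fin n ⊕ Fin n => ℝ)
  refine ⟨((MeasurableEquiv.toLp 2 (Fin n → ℝ)).symm.prodCongr
    (MeasurableEquiv.toLp 2 (Fin n → ℝ)).symm).trans
      ((MeasurableEquiv.sumPiEquivProdPi (fun _ : Fin n ⊕ Fin n => ℝ)).symm.trans
        (MeasurableEquiv.toLp 2 (Fin n ⊕ Fin n → ℝ))), h2.comp (h3.comp (h1.prod h1)), ?_⟩
  intro q
  ext (i | i) <;> rfl

theorem phase_integral (f : Phase n → ℂ) :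
    ∫ z, f z = ∫ q : Config n × Config n, f (phasePt q.1 q.2) := by
  obtain ⟨e, he, hq⟩ := measurePreserving_phasePt (n := n)
  rw [← he.integral_comp' f]
  simp [hq]

theorem phase_integrable {f : Phase n → ℂ} (hf : Integrable f) :
    Integrable (fun q : Config n × Config n => f (phasePt q.1 q.2)) := by
  obtain ⟨e, he, hq⟩ := measurePreserving_phasePt (n := n)
  have := (he.integrable_comp_emb e.measurableEmbedding).2 hf
  simpa [Function.comp_def, hq] using this

theorem hasTemperateGrowth_cexp : (fun t : ℝ => Complex.exp (t * Complex.I)).HasTemperateGrowth := by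
  refine ⟨Complex.contDiff_exp.comp (Complex.ofRealCLM.contDiff.mul contDiff_const), fun k => ⟨0, 1, fun t => ?_⟩⟩
  rw [norm_iteratedFDeriv_eq_norm_iteratedDeriv]
  have : ∀ t : ℝ, iteratedDeriv k (fun t : ℝ => Complex.exp (t * Complex.I)) t
      = Complex.I ^ k * Complex.exp (t * Complex.I) := by
    induction k with
    | zero => simp
    | succ k ih =>
      intro t
      rw [iteratedDeriv_succ, funext ih]
      have : HasDerivAt (fun t : ℝ => Complex.exp (t * Complex.I))
          (Complex.exp (t * Complex.I) * (1 * Complex.I)) t :=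
        ((Complex.ofRealCLM.hasDerivAt (x := t)).mul_const Complex.I).cexp
      rw [(this.const_mul _).deriv]
      ring
  rw [this]
  simp [Complex.norm_exp_ofReal_mul_I]

theorem hasTemperateGrowth_cexp_comp {E : Type*} [NormedAddCommGroup E] [NormedSpace ℝ E]
    {f : E → ℝ} (hf : f.HasTemperateGrowth) :
    (fun x => Complex.exp ((f x : ℝ) * Complex.I)).HasTemperateGrowth :=
  hasTemperateGrowth_cexp.comp hf

theorem hasTemperateGrowth_sinc : Real.sinc.HasTemperateGrowth := by
  set r : ℝ := (2 * π)⁻¹ with hr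
  set f : ℝ → ℂ := (Set.Ioc (-r) r).indicator fun _ => (π : ℂ) with hf
  have hr0 : 0 < r := by positivity
  have hint : ∀ g : ℝ → ℂ, Continuous g → Integrable (fun v => g v * f v) := by
    intro g hg
    have : (fun v => g v * f v) = (Set.Ioc (-r) r).indicator fun v => g v * π := by
      ext v; simp [hf, Set.indicator]
    rw [this, integrable_indicator_iff measurableSet_Ioc]
    exact ((hg.mul continuous_const).continuousOn.integrableOn_Icc).mono_set Set.Ioc_subset_Icc_self
  have key : ∀ t : ℝ, 𝓕 f t = (Real.sinc t : ℂ) := by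
    intro t
    have h1 : 𝓕 f t = ∫ v in -r..r, Complex.exp (((-2 * π * t * v : ℝ) : ℂ) * Complex.I) * π := by
      rw [Real.fourier_real_eq_integral_exp_smul, intervalIntegral.integral_of_le (by linarith),
        ← integral_indicator measurableSet_Ioc]
      congr 1
      ext v
      simp only [hf, Set.indicator]
      split_ifs
      · simp; congr 1; ring
      · simp
    rw [h1]
    rcases eq_or_ne t 0 with rfl | ht
    · simp [hr]
      field_simp
      norm_num
    · have h2 := intervalIntegral.integral_comp_mul_left
        (fun u : ℝ => Complex.exp ((u : ℂ) * Complex.I)) (a := -r) (b := r) (c := -2 * π * t)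
        (by simp [ht, Real.pi_ne_zero])
      have e1 : -2 * π * t * -r = t := by rw [hr]; field_simp
      have e2 : -2 * π * t * r = -t := by rw [hr]; field_simp
      rw [intervalIntegral.integral_mul_const, h2, e1, e2, intervalIntegral.integral_symm,
        integral_exp_mul_I_eq_sinc]
      have : (t : ℂ) ≠ 0 := by exact_mod_cast ht
      have hpi : (π : ℂ) ≠ 0 := by exact_mod_cast Real.pi_ne_zero
      simp
      field_simp
  have hI : ∀ k : ℕ, (k : ℕ∞) ≤ ⊤ → Integrable (fun x : ℝ => x ^ k • f x) := by
    intro k _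
    have := hint (fun v => ((v ^ k : ℝ) : ℂ)) (by fun_prop)
    simpa using this
  have hF : (𝓕 f).HasTemperateGrowth := by
    refine ⟨Real.contDiff_fourier (N := ⊤) fun k hk => ?_, fun k => ⟨0, ∫ v : ℝ, ‖(-2 * π * Complex.I * v) ^ k • f v‖, fun t => ?_⟩⟩
    · simpa [norm_smul] using (hI k hk).norm
    · rw [norm_iteratedFDeriv_eq_norm_iteratedDeriv, Real.iteratedDeriv_fourier hI le_top]
      simp only [pow_zero, mul_one]
      exact VectorFourier.norm_fourierIntegral_le_integral_norm _ _ _ _ _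
  have hre : Real.sinc = Complex.reCLM ∘ 𝓕 f := by
    ext t; simp [key]
  rw [hre]
  exact (Complex.reCLM.hasTemperateGrowth).comp hF

theorem hasTemperateGrowth_mom_pos :
    (fun z : Phase n => ⟪mom z, pos z⟫_ℝ).HasTemperateGrowth := by
  have := ContinuousLinearMap.bilinear_hasTemperateGrowth (𝕜 := ℝ) (innerSL ℝ (E := Config n)) (f := fun z : Phase n => mom z) (g := fun z => pos z) (by fun_prop) (by fun_prop)
  exact this

theorem norm_iteratedFDeriv_comp_le_of_norm_le_one (f : 𝓢(Config n, ℂ)) (g : Phase n →L[ℝ] Config n)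
    (hg : ‖g‖ ≤ 1) (i : ℕ) (z : Phase n) :
    ‖iteratedFDeriv ℝ i (fun w => f (g w)) z‖ ≤ ‖iteratedFDeriv ℝ i f (g z)‖ := by
  have h := g.iteratedFDeriv_comp_right (f := f) (f.smooth ⊤) z (i := i) (mod_cast le_top)
  change ‖iteratedFDeriv ℝ i (f ∘ g) z‖ ≤ _
  rw [h]
  refine (ContinuousMultilinearMap.norm_compContinuousLinearMap_le _ _).trans ?_
  refine mul_le_of_le_one_right (norm_nonneg _) ?_
  simpa using pow_le_one₀ (norm_nonneg _) hg

theorem opNorm_pos_le : ‖(pos : Phase n →L[ℝ] Config n)‖ ≤ 1 :=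
  ContinuousLinearMap.opNorm_le_bound _ zero_le_one fun z => by simpa using norm_pos_le z

theorem opNorm_mom_le : ‖(mom : Phase n →L[ℝ] Config n)‖ ≤ 1 :=
  ContinuousLinearMap.opNorm_le_bound _ zero_le_one fun z => by simpa using norm_mom_le z

/-- The tensor product `(x, p) ↦ f x * g p`, as a continuous linear function of `g`. -/
def tensorRight (f : 𝓢(Config n, ℂ)) : 𝓢(Config n, ℂ) →L[ℂ] 𝓢(Phase n, ℂ) :=
  mkCLM (fun g z => f (pos z) * g (mom z)) (fun _ _ _ => by simp [mul_add])
    (fun _ _ _ => by simp; ring)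
    (fun g => ((f.smooth ⊤).comp pos.contDiff).mul ((g.smooth ⊤).comp mom.contDiff)) <| by
  rintro ⟨k, m⟩
  set A : ℝ := (Finset.Iic (k, m)).sup (schwartzSeminormFamily ℂ (Config n) ℂ) f with hA
  have hA0 : 0 ≤ A := apply_nonneg _ _
  refine ⟨Finset.Iic (k, m), ∑ i ∈ Finset.range (m + 1), (m.choose i : ℝ) * (2 ^ k * A) * 2 ^ k,
    by positivity, fun g z => ?_⟩
  set B : ℝ := (Finset.Iic (k, m)).sup (schwartzSeminormFamily ℂ (Config n) ℂ) g with hB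
  have h1 := norm_iteratedFDeriv_mul_le (𝕜 := ℝ) (N := ∞) (f := fun z : Phase n => f (pos z))
    (g := fun z : Phase n => g (mom z)) ((f.smooth ⊤).comp pos.contDiff)
    ((g.smooth ⊤).comp mom.contDiff) z (n := m) (mod_cast le_top)
  have h2 : ‖z‖ ^ k ≤ (1 + ‖pos z‖) ^ k * (1 + ‖mom z‖) ^ k := by
    rw [← mul_pow]
    gcongr
    nlinarith [phase_norm_le z, mul_nonneg (norm_nonneg (pos z)) (norm_nonneg (mom z))]
  calc ‖z‖ ^ k * ‖iteratedFDeriv ℝ m (fun z => f (pos z) * g (mom z)) z‖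
      ≤ ((1 + ‖pos z‖) ^ k * (1 + ‖mom z‖) ^ k) *
        ∑ i ∈ Finset.range (m + 1), (m.choose i : ℝ) * ‖iteratedFDeriv ℝ i f (pos z)‖ *
          ‖iteratedFDeriv ℝ (m - i) g (mom z)‖ := by
        gcongr
        refine h1.trans ?_
        gcongr
        · exact norm_iteratedFDeriv_comp_le_of_norm_le_one f pos opNorm_pos_le _ z
        · exact norm_iteratedFDeriv_comp_le_of_norm_le_one g mom opNorm_mom_le _ z
    _ ≤ (∑ i ∈ Finset.range (m + 1), (m.choose i : ℝ) * (2 ^ k * A) * 2 ^ k) * B := by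
        rw [Finset.mul_sum, Finset.sum_mul]
        refine Finset.sum_le_sum fun i hi => ?_
        have hi' : i ≤ m := Nat.lt_succ_iff.1 (Finset.mem_range.1 hi)
        have e1 := one_add_le_sup_seminorm_apply (𝕜 := ℂ) (m := (k, m)) (k := k) le_rfl hi' f
          (pos z)
        have e2 := one_add_le_sup_seminorm_apply (𝕜 := ℂ) (m := (k, m)) (k := k) (n := m - i)
          le_rfl (Nat.sub_le _ _) g (mom z)
        change _ ≤ 2 ^ k * A at e1
        change _ ≤ 2 ^ k * B at e2
        calc _ = (m.choose i : ℝ) * ((1 + ‖pos z‖) ^ k * ‖iteratedFDeriv ℝ i f (pos z)‖) *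
              ((1 + ‖mom z‖) ^ k * ‖iteratedFDeriv ℝ (m - i) g (mom z)‖) := by ring
          _ ≤ (m.choose i : ℝ) * (2 ^ k * A) * (2 ^ k * B) := by gcongr
          _ = _ := by ring

@[simp] theorem tensorRight_apply (f g : 𝓢(Config n, ℂ)) (z : Phase n) :
    tensorRight f g z = f (pos z) * g (mom z) := rfl

/-- The linear automorphism `(x, p) ↦ (c p, d x)` of phase space. -/
def phaseEquiv (c d : ℝ) (hc : c ≠ 0) (hd : d ≠ 0) : Phase n ≃L[ℝ] Phase n :=
  LinearEquiv.toContinuousLinearEquiv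
    { toFun := fun z => phasePt (c • mom z) (d • pos z)
      invFun := fun z => phasePt (d⁻¹ • mom z) (c⁻¹ • pos z)
      map_add' := fun z w => by apply phase_ext <;> simp
      map_smul' := fun r z => by apply phase_ext <;> simp [smul_comm r]
      left_inv := fun z => by apply phase_ext <;> simp [smul_smul, hc, hd]
      right_inv := fun z => by apply phase_ext <;> simp [smul_smul, hc, hd] }

@[simp] theorem phaseEquiv_apply (c d : ℝ) (hc : c ≠ 0) (hd : d ≠ 0) (z : Phase n) :
    phaseEquiv c d hc hd z = phasePt (c • mom z) (d • pos z) := rfl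

/-- The tensor product `(x, p) ↦ f x * g p`, as a continuous linear function of `f`. -/
def tensorLeft (g : 𝓢(Config n, ℂ)) : 𝓢(Config n, ℂ) →L[ℂ] 𝓢(Phase n, ℂ) :=
  compCLMOfContinuousLinearEquiv ℂ (phaseEquiv 1 1 one_ne_zero one_ne_zero) ∘L tensorRight g

theorem tensorLeft_eq (f g : 𝓢(Config n, ℂ)) : tensorLeft g f = tensorRight f g := by
  ext z
  simp [tensorLeft, mul_comm]

/-- The Heisenberg operator
`(T̂(z₀)ψ)(x) = exp((i/ħ)(p₀·x - p₀·x₀/2)) ψ(x - x₀)`, `z₀ = (x₀, p₀)`. -/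
def heisenberg (ħ : ℝ) (z₀ : Phase n) : 𝓢(Config n, ℂ) →L[ℂ] 𝓢(Config n, ℂ) :=
  smulLeftCLM ℂ (fun x : Config n =>
    Complex.exp (((⟪mom z₀, x⟫_ℝ - ⟪mom z₀, pos z₀⟫_ℝ / 2) / ħ : ℝ) * Complex.I)) ∘L
  compSubConstCLM ℂ (pos z₀)

theorem heisenberg_apply (ħ : ℝ) (z₀ : Phase n) (ψ : 𝓢(Config n, ℂ)) (x : Config n) :
    heisenberg ħ z₀ ψ x =
      Complex.exp (((⟪mom z₀, x⟫_ℝ - ⟪mom z₀, pos z₀⟫_ℝ / 2) / ħ : ℝ) * Complex.I) *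
        ψ (x - pos z₀) := by
  have h : (fun x : Config n => (⟪mom z₀, x⟫_ℝ - ⟪mom z₀, pos z₀⟫_ℝ / 2) / ħ).HasTemperateGrowth := by
    simp only [div_eq_mul_inv]
    fun_prop
  rw [heisenberg, ContinuousLinearMap.comp_apply,
    smulLeftCLM_apply_apply (hasTemperateGrowth_cexp_comp h)]
  simp

/-- The first chirp in the factorization of the matrix coefficients of the Heisenberg operators. -/
def chirpIn (z : Phase n) : ℂ := Complex.exp ((2 * π * ⟪mom z, pos z⟫_ℝ : ℝ) * Complex.I)

/-- The second chirp in the factorization of the matrix coefficients of the Heisenberg operators. -/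
def chirpOut (ħ : ℝ) (z : Phase n) : ℂ :=
  Complex.exp ((-(2 * ħ)⁻¹ * ⟪mom z, pos z⟫_ℝ : ℝ) * Complex.I)

theorem chirpIn_growth : (chirpIn (n := n)).HasTemperateGrowth := by
  have := hasTemperateGrowth_mom_pos (n := n)
  exact hasTemperateGrowth_cexp_comp (by fun_prop)

theorem chirpOut_growth (ħ : ℝ) : (chirpOut (n := n) ħ).HasTemperateGrowth := by
  have := hasTemperateGrowth_mom_pos (n := n)
  exact hasTemperateGrowth_cexp_comp (by fun_prop)

/-- The map `F ↦ chirpOut · (𝓕 (chirpIn · F)) ∘ Λ` with `Λ (x, p) = (-p / (2πħ), x)`. -/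
def coeffOp {ħ : ℝ} (hħ : 0 < ħ) : 𝓢(Phase n, ℂ) →L[ℂ] 𝓢(Phase n, ℂ) :=
  smulLeftCLM ℂ (chirpOut ħ) ∘L
    compCLMOfContinuousLinearEquiv ℂ
      (phaseEquiv (-(2 * π * ħ)⁻¹) 1 (by have := Real.pi_pos; simp [hħ.ne', this.ne']) one_ne_zero) ∘L
    fourierCLM ℂ 𝓢(Phase n, ℂ) ∘L smulLeftCLM ℂ chirpIn

theorem coeffOp_apply {ħ : ℝ} (hħ : 0 < ħ) (ψ φ : 𝓢(Config n, ℂ)) (z : Phase n) :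
    coeffOp hħ (tensorRight φ (𝓕 ψ)) z = ∫ x, heisenberg ħ z ψ x * φ x := by
  have hinv : ∀ y, ψ y = ∫ ξ, Complex.exp ((2 * π * ⟪ξ, y⟫_ℝ : ℝ) * Complex.I) * 𝓕 ψ ξ := by
    intro y
    have h : ψ y = 𝓕⁻ (𝓕 ψ) y := by rw [fourierInv_fourier_eq]
    rw [h, fourierInv_coe, Real.fourierInv_eq']
    simp
  rw [coeffOp]
  simp only [ContinuousLinearMap.comp_apply]
  rw [smulLeftCLM_apply_apply (chirpOut_growth ħ), compCLMOfContinuousLinearEquiv_apply,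
    Function.comp_apply, fourierCLM_apply, fourier_coe, Real.fourier_eq', phase_integral]
  set u : Phase n := phaseEquiv (-(2 * π * ħ)⁻¹) 1 (by have := Real.pi_pos; simp [hħ.ne', this.ne'])
    one_ne_zero z with hu
  have hint2 : Integrable (fun q : Config n × Config n =>
      Complex.exp (((-2 * π * ⟪phasePt q.1 q.2, u⟫_ℝ : ℝ) : ℂ) * Complex.I) •
        (smulLeftCLM ℂ chirpIn (tensorRight φ (𝓕 ψ))) (phasePt q.1 q.2)) := by
    have hg : (fun w : Phase n => -2 * π * ⟪w, u⟫_ℝ).HasTemperateGrowth := by fun_prop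
    have := phase_integrable ((smulLeftCLM ℂ (fun w : Phase n => Complex.exp
      (((-2 * π * ⟪w, u⟫_ℝ : ℝ) : ℂ) * Complex.I))
      (smulLeftCLM ℂ chirpIn (tensorRight φ (𝓕 ψ)))).integrable (μ := volume))
    simpa only [smulLeftCLM_apply_apply (hasTemperateGrowth_cexp_comp hg)] using this
  rw [show (volume : Measure (Config n × Config n)) = volume.prod volume from rfl] at hint2 ⊢
  rw [integral_prod _ hint2, smul_eq_mul, ← integral_const_mul]
  congr 1
  ext x
  rw [heisenberg_apply, hinv, ← integral_const_mul, ← integral_const_mul, ← integral_mul_const]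
  congr 1
  ext ξ
  rw [smulLeftCLM_apply_apply chirpIn_growth]
  simp only [tensorRight_apply, chirpIn, chirpOut, pos_phasePt, mom_phasePt, phase_inner, smul_eq_mul]
  rw [← mul_assoc, ← mul_assoc, ← Complex.exp_add, ← mul_assoc, ← Complex.exp_add, ← mul_assoc,
    ← Complex.exp_add, mul_right_comm]
  congr 3
  have hp : (π : ℝ) ≠ 0 := Real.pi_ne_zero
  have hh : ħ ≠ 0 := hħ.ne'
  simp only [hu, phaseEquiv_apply, pos_phasePt, mom_phasePt, one_smul, inner_smul_right,
    inner_sub_right, ← add_mul, ← Complex.ofReal_add]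
  congr 2
  rw [real_inner_comm x (mom z)]
  field_simp
  ring

/-- The matrix coefficient `z ↦ ⟨T̂(z)ψ, φ⟩ = ∫ (T̂(z)ψ)(x) φ(x) dx` (bilinear pairing), which is a
Schwartz function on phase space. -/
def matrixCoeff {ħ : ℝ} (hħ : 0 < ħ) (ψ φ : 𝓢(Config n, ℂ)) : 𝓢(Phase n, ℂ) where
  toFun z := ∫ x, heisenberg ħ z ψ x * φ x
  smooth' := by
    rw [← funext (coeffOp_apply hħ ψ φ)]
    exact (coeffOp hħ (tensorRight φ (𝓕 ψ))).smooth'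
  decay' := by
    rw [← funext (coeffOp_apply hħ ψ φ)]
    exact (coeffOp hħ (tensorRight φ (𝓕 ψ))).decay'

theorem matrixCoeff_apply {ħ : ℝ} (hħ : 0 < ħ) (ψ φ : 𝓢(Config n, ℂ)) (z : Phase n) :
    matrixCoeff hħ ψ φ z = ∫ x, heisenberg ħ z ψ x * φ x := rfl

theorem matrixCoeff_eq {ħ : ℝ} (hħ : 0 < ħ) (ψ φ : 𝓢(Config n, ℂ)) :
    matrixCoeff hħ ψ φ = coeffOp hħ (tensorRight φ (𝓕 ψ)) :=
  SchwartzMap.ext fun z => (coeffOp_apply hħ ψ φ z).symm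

theorem matrixCoeff_eq_right {ħ : ℝ} (hħ : 0 < ħ) (ψ φ : 𝓢(Config n, ℂ)) :
    matrixCoeff hħ ψ φ = (coeffOp hħ ∘L tensorLeft (𝓕 ψ)) φ := by
  rw [matrixCoeff_eq, ContinuousLinearMap.comp_apply, tensorLeft_eq]

theorem matrixCoeff_eq_left {ħ : ℝ} (hħ : 0 < ħ) (ψ φ : 𝓢(Config n, ℂ)) :
    matrixCoeff hħ ψ φ =
      (coeffOp hħ ∘L tensorRight φ ∘L fourierCLM ℂ 𝓢(Config n, ℂ)) ψ := by
  rw [matrixCoeff_eq]; rfl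

/-- The matrix coefficient as a continuous linear function of `φ`. -/
def matrixCoeffCLM {ħ : ℝ} (hħ : 0 < ħ) (ψ : 𝓢(Config n, ℂ)) :
    𝓢(Config n, ℂ) →L[ℂ] 𝓢(Phase n, ℂ) where
  toFun φ := matrixCoeff hħ ψ φ
  map_add' φ χ := by simp only [matrixCoeff_eq_right, map_add]
  map_smul' c φ := by simp only [matrixCoeff_eq_right, map_smul, RingHom.id_apply]
  cont := by
    simp only [matrixCoeff_eq_right]
    exact (coeffOp hħ ∘L tensorLeft (𝓕 ψ)).continuous

/-- `Θ(x, p) = sin (p·x / 2ħ) / (p·x / 2ħ)`, equal to `1` where `p·x = 0`. -/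
def theta (ħ : ℝ) (z : Phase n) : ℂ := (Real.sinc (⟪mom z, pos z⟫_ℝ / (2 * ħ)) : ℝ)

theorem theta_growth (ħ : ℝ) : (theta (n := n) ħ).HasTemperateGrowth := by
  have h := hasTemperateGrowth_mom_pos (n := n)
  have h2 : (fun z : Phase n => ⟪mom z, pos z⟫_ℝ / (2 * ħ)).HasTemperateGrowth := by
    simp only [div_eq_mul_inv]; fun_prop
  exact Function.Complex.hasTemperateGrowth_ofReal.comp (hasTemperateGrowth_sinc.comp h2)

/-- The composition `a ∘ g` of a tempered distribution with a linear automorphism: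
`⟨a ∘ g, φ⟩ = |det g|⁻¹ ⟨a, φ ∘ g⁻¹⟩`. -/
def distComp (a : 𝓢'(Phase n, ℂ)) (g : Phase n ≃L[ℝ] Phase n) : 𝓢'(Phase n, ℂ) :=
  ((|(g : Phase n →L[ℝ] Phase n).det|⁻¹ : ℝ) : ℂ) •
    PointwiseConvergenceCLM.precomp ℂ (compCLMOfContinuousLinearEquiv ℂ g.symm) a

theorem distComp_apply (a : 𝓢'(Phase n, ℂ)) (g : Phase n ≃L[ℝ] Phase n) (φ : 𝓢(Phase n, ℂ)) :
    distComp a g φ = ((|(g : Phase n →L[ℝ] Phase n).det|⁻¹ : ℝ) : ℂ) *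
      a (compCLMOfContinuousLinearEquiv ℂ g.symm φ) := rfl

theorem integral_comp_cle {ι : Type*} [Fintype ι]
    (g : EuclideanSpace ℝ ι ≃L[ℝ] EuclideanSpace ℝ ι) (F : EuclideanSpace ℝ ι → ℂ) :
    ∫ x, F (g x) =
      ((|(g : EuclideanSpace ℝ ι →L[ℝ] EuclideanSpace ℝ ι).det|⁻¹ : ℝ) : ℂ) * ∫ x, F x := by
  have hdet : LinearMap.det (g : EuclideanSpace ℝ ι →ₗ[ℝ] EuclideanSpace ℝ ι) ≠ 0 :=
    (LinearEquiv.isUnit_det' g.toLinearEquiv).ne_zero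
  have h := Measure.map_linearMap_addHaar_eq_smul_addHaar
    (volume : Measure (EuclideanSpace ℝ ι)) hdet
  have h2 := g.toHomeomorph.toMeasurableEquiv.measurableEmbedding.integral_map
    (μ := volume) F
  change ∫ y, F y ∂(Measure.map g volume) = ∫ x, F (g x) at h2
  change Measure.map g volume = _ at h
  rw [← h2, h, integral_smul_measure, ENNReal.toReal_ofReal (abs_nonneg _), abs_inv]
  rfl

/-- For a Schwartz function, `distComp` is composition of functions. -/
theorem distComp_coe (b : 𝓢(Phase n, ℂ)) (g : Phase n ≃L[ℝ] Phase n) :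
    distComp (b : 𝓢'(Phase n, ℂ)) g = (compCLMOfContinuousLinearEquiv ℂ g b : 𝓢(Phase n, ℂ)) := by
  ext φ
  rw [distComp_apply, SchwartzMap.coe_apply, SchwartzMap.coe_apply]
  have h := integral_comp_cle g fun x => φ (g.symm x) * b x
  rw [eq_comm]
  simpa using h

/-- The symplectic form `σ(z, z') = Jz · z' = p · x' - p' · x`. -/
def sympForm (z w : Phase n) : ℝ := ⟪mom z, pos w⟫_ℝ - ⟪mom w, pos z⟫_ℝ

theorem two_pi_hbar_inv_ne {ħ : ℝ} (hħ : 0 < ħ) : (2 * π * ħ)⁻¹ ≠ 0 := by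
  have := Real.pi_pos
  positivity

/-- The automorphism `z ↦ (2πħ)⁻¹ J z`, `J (x, p) = (p, -x)`, of phase space. -/
def scaledJ {ħ : ℝ} (hħ : 0 < ħ) : Phase n ≃L[ℝ] Phase n :=
  phaseEquiv (2 * π * ħ)⁻¹ (-(2 * π * ħ)⁻¹) (two_pi_hbar_inv_ne hħ)
    (neg_ne_zero.2 (two_pi_hbar_inv_ne hħ))

/-- The symplectic Fourier transform
`a_σ(z) = (2πħ)⁻ⁿ ∫ exp(-(i/ħ)σ(z,z')) a(z') dz' = (2πħ)⁻ⁿ (𝓕 a)((2πħ)⁻¹ J z)` on tempered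
distributions; here `(𝓕 a)(w) = ∫ exp(-2πi w·z') a(z') dz'`. -/
def sympFourier {ħ : ℝ} (hħ : 0 < ħ) (a : 𝓢'(Phase n, ℂ)) : 𝓢'(Phase n, ℂ) :=
  (((1 / (2 * π * ħ)) ^ n : ℝ) : ℂ) • distComp (𝓕 a) (scaledJ hħ)

/-- On Schwartz functions the symplectic Fourier transform is given by its integral formula. -/
theorem sympFourier_coe {ħ : ℝ} (hħ : 0 < ħ) (b φ : 𝓢(Phase n, ℂ)) :
    sympFourier hħ (b : 𝓢'(Phase n, ℂ)) φ =
      ∫ z, φ z * ((((1 / (2 * π * ħ)) ^ n : ℝ) : ℂ) *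
        ∫ w, Complex.exp ((-sympForm z w / ħ : ℝ) * Complex.I) * b w) := by
  rw [sympFourier, TemperedDistribution.fourier_toTemperedDistributionCLM_eq, distComp_coe]
  change (((1 / (2 * π * ħ)) ^ n : ℝ) : ℂ) • ((compCLMOfContinuousLinearEquiv ℂ (scaledJ hħ) (𝓕 b) : 𝓢(Phase n, ℂ)) :
    𝓢'(Phase n, ℂ)) φ = _
  rw [SchwartzMap.coe_apply, ← integral_smul]
  congr 1
  ext z
  simp only [smul_eq_mul, compCLMOfContinuousLinearEquiv_apply, Function.comp_apply]
  rw [fourier_coe, Real.fourier_eq']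
  rw [mul_left_comm]
  congr 3
  ext w
  rw [smul_eq_mul]
  congr 4
  have hp : (π : ℝ) ≠ 0 := Real.pi_ne_zero
  have hh : ħ ≠ 0 := hħ.ne'
  simp only [scaledJ, phaseEquiv_apply, phase_inner, pos_phasePt, mom_phasePt, sympForm,
    inner_smul_right]
  rw [real_inner_comm (mom z)]
  field_simp
  ring

/-- The Born–Jordan operator `Op_BJ(a) : 𝓢(ℝⁿ) → 𝓢'(ℝⁿ)` with symbol `a ∈ 𝓢'(ℝ²ⁿ)`,
`Op_BJ(a)ψ = (2πħ)⁻ⁿ ∫ a_σ(z) Θ(z) T̂(z)ψ dz`, the integral being understood weakly: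
`⟨Op_BJ(a)ψ, φ⟩ = (2πħ)⁻ⁿ ⟨Θ a_σ, z ↦ ⟨T̂(z)ψ, φ⟩⟩`. -/
def opBJ {ħ : ℝ} (hħ : 0 < ħ) (a : 𝓢'(Phase n, ℂ)) : 𝓢(Config n, ℂ) →L[ℂ] 𝓢'(Config n, ℂ) where
  toFun ψ := (((1 / (2 * π * ħ)) ^ n : ℝ) : ℂ) •
    PointwiseConvergenceCLM.precomp ℂ (matrixCoeffCLM hħ ψ)
      (TemperedDistribution.smulLeftCLM ℂ (theta ħ) (sympFourier hħ a))
  map_add' ψ χ := by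
    ext φ
    have h : matrixCoeff hħ (ψ + χ) φ = matrixCoeff hħ ψ φ + matrixCoeff hħ χ φ := by
      simp only [matrixCoeff_eq_left, map_add]
    change _ * sympFourier hħ a (smulLeftCLM ℂ (theta ħ) (matrixCoeff hħ (ψ + χ) φ)) =
      _ * sympFourier hħ a (smulLeftCLM ℂ (theta ħ) (matrixCoeff hħ ψ φ)) +
      _ * sympFourier hħ a (smulLeftCLM ℂ (theta ħ) (matrixCoeff hħ χ φ))
    rw [h, map_add, map_add, mul_add]
  map_smul' c ψ := by
    ext φ
    have h : matrixCoeff hħ (c • ψ) φ = c • matrixCoeff hħ ψ φ := by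
      simp only [matrixCoeff_eq_left, map_smul]
    change _ * sympFourier hħ a (smulLeftCLM ℂ (theta ħ) (matrixCoeff hħ (c • ψ) φ)) =
      c * (_ * sympFourier hħ a (smulLeftCLM ℂ (theta ħ) (matrixCoeff hħ ψ φ)))
    rw [h, map_smul, map_smul, smul_eq_mul, mul_left_comm]
  cont := by
    refine PointwiseConvergenceCLM.continuous_of_continuous_eval fun φ => ?_
    change Continuous fun ψ => (((1 / (2 * π * ħ)) ^ n : ℝ) : ℂ) *
      sympFourier hħ a (smulLeftCLM ℂ (theta ħ) (matrixCoeff hħ ψ φ))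
    simp only [matrixCoeff_eq_left]
    exact continuous_const.mul ((sympFourier hħ a).continuous.comp
      ((smulLeftCLM ℂ (theta ħ)).continuous.comp (ContinuousLinearMap.continuous _)))

theorem opBJ_apply {ħ : ℝ} (hħ : 0 < ħ) (a : 𝓢'(Phase n, ℂ)) (ψ φ : 𝓢(Config n, ℂ)) :
    opBJ hħ a ψ φ = (((1 / (2 * π * ħ)) ^ n : ℝ) : ℂ) *
      sympFourier hħ a (smulLeftCLM ℂ (theta ħ) (matrixCoeff hħ ψ φ)) := rfl

/-- The action of a symplectic matrix on phase space. -/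
def sympEquiv : Matrix.symplecticGroup (Fin n) ℝ →* (Phase n ≃L[ℝ] Phase n) :=
  (ContinuousLinearEquiv.unitsEquiv ℝ (Phase n)).toMonoidHom.comp
    (MonoidHom.toHomUnits
      (((Matrix.toEuclideanCLM (n := Fin n ⊕ Fin n) (𝕜 := ℝ) : _ →* _)).comp
        (Matrix.symplecticGroup (Fin n) ℝ).subtype))

theorem sympEquiv_apply (s : Matrix.symplecticGroup (Fin n) ℝ) (z : Phase n) :
    sympEquiv s z = WithLp.toLp 2 ((s : Matrix _ _ ℝ) *ᵥ z.ofLp) := rfl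

/-- The action of an invertible matrix on configuration space. -/
def glEquiv (L : GL (Fin n) ℝ) : Config n ≃L[ℝ] Config n :=
  ContinuousLinearEquiv.unitsEquiv ℝ (Config n)
    (Units.map (Matrix.toEuclideanCLM (n := Fin n) (𝕜 := ℝ) : _ →* _) L)

theorem glEquiv_apply (L : GL (Fin n) ℝ) (x : Config n) :
    glEquiv L x = WithLp.toLp 2 ((L : Matrix _ _ ℝ) *ᵥ x.ofLp) := rfl

/-- `J = (0, I; -I, 0)`, that is `J (x, p) = (p, -x)`. -/
def sympJ (n : ℕ) : Matrix.symplecticGroup (Fin n) ℝ :=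
  ⟨Matrix.fromBlocks 0 1 (-1) 0, SymplecticGroup.fromBlocks_mem_iff.2 (by simp)⟩

/-- `M_L = (L⁻¹, 0; 0, Lᵀ)`. -/
def sympM (L : GL (Fin n) ℝ) : Matrix.symplecticGroup (Fin n) ℝ :=
  ⟨Matrix.fromBlocks (L⁻¹ : GL (Fin n) ℝ) 0 0 (L : Matrix (Fin n) (Fin n) ℝ)ᵀ,
    SymplecticGroup.fromBlocks_mem_iff.2 (by
      simp [← Matrix.transpose_mul])⟩

/-- `V_P = (I, 0; -P, I)` for a symmetric matrix `P`. -/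
def sympV (P : Matrix (Fin n) (Fin n) ℝ) (hP : P.IsSymm) : Matrix.symplecticGroup (Fin n) ℝ :=
  ⟨Matrix.fromBlocks 1 0 (-P) 1, SymplecticGroup.fromBlocks_mem_iff.2 (by simp [hP.eq])⟩

theorem pos_sympJ (z : Phase n) : pos (sympEquiv (sympJ n) z) = mom z := by
  ext i; simp [sympEquiv_apply, sympJ, Matrix.fromBlocks_mulVec]

theorem mom_sympJ (z : Phase n) : mom (sympEquiv (sympJ n) z) = -pos z := by
  ext i; simp [sympEquiv_apply, sympJ, Matrix.fromBlocks_mulVec, Matrix.neg_mulVec]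

theorem pos_sympM (L : GL (Fin n) ℝ) (z : Phase n) :
    pos (sympEquiv (sympM L) z) = (glEquiv L).symm (pos z) := by
  rw [ContinuousLinearEquiv.eq_symm_apply]
  ext i
  have : (L : Matrix (Fin n) (Fin n) ℝ) *ᵥ (((L⁻¹ : GL (Fin n) ℝ) : Matrix (Fin n) (Fin n) ℝ) *ᵥ
    (pos z).ofLp) = (pos z).ofLp := by
    simp [Matrix.mulVec_mulVec]
  have h : (pos (sympEquiv (sympM L) z)).ofLp =
      ((L⁻¹ : GL (Fin n) ℝ) : Matrix (Fin n) (Fin n) ℝ) *ᵥ (pos z).ofLp := by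
    ext i
    simp [sympEquiv_apply, sympM, Matrix.fromBlocks_mulVec]
    rfl
  rw [← congrFun this i, glEquiv_apply, h]

theorem inner_mom_sympM (L : GL (Fin n) ℝ) (z : Phase n) (x : Config n) :
    ⟪mom (sympEquiv (sympM L) z), x⟫_ℝ = ⟪mom z, glEquiv L x⟫_ℝ := by
  have h : (mom (sympEquiv (sympM L) z)).ofLp =
      (L : Matrix (Fin n) (Fin n) ℝ)ᵀ *ᵥ (mom z).ofLp := by
    ext i
    simp [sympEquiv_apply, sympM, Matrix.fromBlocks_mulVec]
    rfl
  rw [EuclideanSpace.inner_eq_star_dotProduct, EuclideanSpace.inner_eq_star_dotProduct, h,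
    glEquiv_apply]
  simp only [Matrix.mulVec_transpose, star_trivial]
  rw [dotProduct_comm, ← Matrix.dotProduct_mulVec, dotProduct_comm]

theorem pos_sympV (P : Matrix (Fin n) (Fin n) ℝ) (hP : P.IsSymm) (z : Phase n) :
    pos (sympEquiv (sympV P hP) z) = pos z := by
  ext i; simp [sympEquiv_apply, sympV, Matrix.fromBlocks_mulVec]

theorem mom_sympV (P : Matrix (Fin n) (Fin n) ℝ) (hP : P.IsSymm) (z : Phase n) :
    mom (sympEquiv (sympV P hP) z) = mom z - Matrix.toEuclideanCLM (𝕜 := ℝ) P (pos z) := by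
  ext i; simp [sympEquiv_apply, sympV, Matrix.fromBlocks_mulVec, Matrix.neg_mulVec]
  rw [add_comm, sub_eq_add_neg]; rfl

/-- Composition with a linear automorphism, `ψ ↦ ψ ∘ g`. -/
def compCLE (g : Config n ≃L[ℝ] Config n) : 𝓢(Config n, ℂ) ≃L[ℂ] 𝓢(Config n, ℂ) :=
  ContinuousLinearEquiv.equivOfInverse (compCLMOfContinuousLinearEquiv ℂ g)
    (compCLMOfContinuousLinearEquiv ℂ g.symm)
    (fun ψ => by ext x; simp) (fun ψ => by ext x; simp)

/-- Multiplication by the unimodular function `exp(i f)`. -/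
def mulCLE (f : Config n → ℝ) (hf : f.HasTemperateGrowth) :
    𝓢(Config n, ℂ) ≃L[ℂ] 𝓢(Config n, ℂ) :=
  ContinuousLinearEquiv.equivOfInverse
    (smulLeftCLM ℂ fun x => Complex.exp (((f x : ℝ) : ℂ) * Complex.I))
    (smulLeftCLM ℂ fun x => Complex.exp (((-f x : ℝ) : ℂ) * Complex.I))
    (fun ψ => by
      ext x
      rw [smulLeftCLM_apply_apply (hasTemperateGrowth_cexp_comp (f := fun x => -f x) hf.neg),
        smulLeftCLM_apply_apply (hasTemperateGrowth_cexp_comp hf), smul_smul, ← Complex.exp_add]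
      simp)
    (fun ψ => by
      ext x
      rw [smulLeftCLM_apply_apply (hasTemperateGrowth_cexp_comp hf),
        smulLeftCLM_apply_apply (hasTemperateGrowth_cexp_comp (f := fun x => -f x) hf.neg), smul_smul,
        ← Complex.exp_add]
      simp)

/-- Multiplication by a nonzero constant. -/
def scalarCLE (c : ℂ) (hc : c ≠ 0) : 𝓢(Config n, ℂ) ≃L[ℂ] 𝓢(Config n, ℂ) :=
  ContinuousLinearEquiv.smulLeft (Units.mk0 c hc)

@[simp] theorem compCLE_apply (g : Config n ≃L[ℝ] Config n) (ψ : 𝓢(Config n, ℂ)) (x : Config n) :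
    compCLE g ψ x = ψ (g x) := rfl

@[simp] theorem mulCLE_apply (f : Config n → ℝ) (hf : f.HasTemperateGrowth) (ψ : 𝓢(Config n, ℂ))
    (x : Config n) : mulCLE f hf ψ x = Complex.exp (((f x : ℝ) : ℂ) * Complex.I) * ψ x :=
  smulLeftCLM_apply_apply (hasTemperateGrowth_cexp_comp hf) ψ x

@[simp] theorem scalarCLE_apply (c : ℂ) (hc : c ≠ 0) (ψ : 𝓢(Config n, ℂ)) (x : Config n) :
    scalarCLE c hc ψ x = c * ψ x := rfl

/-- The dilation `x ↦ (2πħ)⁻¹ x`. -/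
def dilation {ħ : ℝ} (hħ : 0 < ħ) : Config n ≃L[ℝ] Config n :=
  ContinuousLinearEquiv.smulLeft (Units.mk0 _ (two_pi_hbar_inv_ne hħ))

@[simp] theorem dilation_apply {ħ : ℝ} (hħ : 0 < ħ) (x : Config n) :
    dilation hħ x = (2 * π * ħ)⁻¹ • x := rfl

theorem JHat_const_ne {ħ : ℝ} (hħ : 0 < ħ) :
    Complex.exp (((-(n * π / 4) : ℝ) : ℂ) * Complex.I) * (((2 * π * ħ) ^ (-(n : ℝ) / 2) : ℝ) : ℂ) ≠ 0 := by
  have : (0 : ℝ) < (2 * π * ħ) ^ (-(n : ℝ) / 2) := by positivity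
  exact mul_ne_zero (Complex.exp_ne_zero _) (by exact_mod_cast this.ne')

/-- `Ĵ = e^{-inπ/4} F`, where `F ψ(ξ) = (2πħ)^{-n/2} ∫ exp(-(i/ħ) ξ·x) ψ(x) dx`
(see `JHat_apply`). -/
def JHat {ħ : ℝ} (hħ : 0 < ħ) : 𝓢(Config n, ℂ) ≃L[ℂ] 𝓢(Config n, ℂ) :=
  scalarCLE _ (JHat_const_ne (n := n) hħ) * compCLE (dilation hħ) * fourierCLE ℂ 𝓢(Config n, ℂ)

theorem JHat_apply {ħ : ℝ} (hħ : 0 < ħ) (ψ : 𝓢(Config n, ℂ)) (ξ : Config n) :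
    JHat hħ ψ ξ = Complex.exp (((-(n * π / 4) : ℝ) : ℂ) * Complex.I) *
      (((2 * π * ħ) ^ (-(n : ℝ) / 2) : ℝ) : ℂ) *
        ∫ x, Complex.exp (((-⟪ξ, x⟫_ℝ / ħ : ℝ) : ℂ) * Complex.I) * ψ x := by
  have h1 : JHat hħ ψ ξ = Complex.exp (((-(n * π / 4) : ℝ) : ℂ) * Complex.I) *
      (((2 * π * ħ) ^ (-(n : ℝ) / 2) : ℝ) : ℂ) * 𝓕 ψ ((2 * π * ħ)⁻¹ • ξ) := rfl
  rw [h1, fourier_coe, Real.fourier_eq']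
  congr 2
  ext x
  rw [smul_eq_mul]
  congr 4
  have hp : (π : ℝ) ≠ 0 := Real.pi_ne_zero
  have hh : ħ ≠ 0 := hħ.ne'
  rw [inner_smul_right, real_inner_comm]
  field_simp

theorem MHat_const_ne (L : GL (Fin n) ℝ) (m : ℤ) :
    Complex.I ^ m * ((√|(L : Matrix (Fin n) (Fin n) ℝ).det| : ℝ) : ℂ) ≠ 0 := by
  have h : (L : Matrix (Fin n) (Fin n) ℝ).det ≠ 0 :=
    ((Matrix.isUnit_iff_isUnit_det _).1 L.isUnit).ne_zero
  exact mul_ne_zero (zpow_ne_zero _ Complex.I_ne_zero)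
    (by exact_mod_cast (Real.sqrt_pos.2 (abs_pos.2 h)).ne')

/-- `(M̂_{L,m} ψ)(x) = i^m √|det L| ψ(Lx)`. -/
def MHat (L : GL (Fin n) ℝ) (m : ℤ) : 𝓢(Config n, ℂ) ≃L[ℂ] 𝓢(Config n, ℂ) :=
  scalarCLE _ (MHat_const_ne L m) * compCLE (glEquiv L)

theorem MHat_apply (L : GL (Fin n) ℝ) (m : ℤ) (ψ : 𝓢(Config n, ℂ)) (x : Config n) :
    MHat L m ψ x = Complex.I ^ m * ((√|(L : Matrix (Fin n) (Fin n) ℝ).det| : ℝ) : ℂ) *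
      ψ (glEquiv L x) := rfl

theorem quadForm_growth (ħ : ℝ) (P : Matrix (Fin n) (Fin n) ℝ) :
    (fun x : Config n =>
      -(⟪Matrix.toEuclideanCLM (𝕜 := ℝ) P x, x⟫_ℝ / (2 * ħ))).HasTemperateGrowth := by
  have := ContinuousLinearMap.bilinear_hasTemperateGrowth (𝕜 := ℝ) (innerSL ℝ (E := Config n))
    (f := fun x : Config n => Matrix.toEuclideanCLM (𝕜 := ℝ) P x) (g := fun x => x)
    (ContinuousLinearMap.hasTemperateGrowth _) (by fun_prop)
  have h2 : (fun x : Config n =>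
    ⟪Matrix.toEuclideanCLM (𝕜 := ℝ) P x, x⟫_ℝ).HasTemperateGrowth := this
  simp only [div_eq_mul_inv]
  fun_prop

/-- `(V̂_P ψ)(x) = exp(-(i/2ħ) Px·x) ψ(x)`. -/
def VHat (ħ : ℝ) (P : Matrix (Fin n) (Fin n) ℝ) : 𝓢(Config n, ℂ) ≃L[ℂ] 𝓢(Config n, ℂ) :=
  mulCLE _ (quadForm_growth ħ P)

theorem VHat_apply (ħ : ℝ) (P : Matrix (Fin n) (Fin n) ℝ) (ψ : 𝓢(Config n, ℂ)) (x : Config n) :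
    VHat ħ P ψ x =
      Complex.exp (((-(⟪Matrix.toEuclideanCLM (𝕜 := ℝ) P x, x⟫_ℝ / (2 * ħ)) : ℝ) : ℂ) *
        Complex.I) * ψ x :=
  mulCLE_apply _ (quadForm_growth ħ P) ψ x

/-- `mπ` is an argument of `det L`. -/
def IsDetArg (L : GL (Fin n) ℝ) (m : ℤ) : Prop :=
  (((L : Matrix (Fin n) (Fin n) ℝ).det : ℝ) : ℂ) =
    (|(L : Matrix (Fin n) (Fin n) ℝ).det| : ℝ) * Complex.exp (((m * π : ℝ) : ℂ) * Complex.I)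

theorem JHat_heisenberg {ħ : ℝ} (hħ : 0 < ħ) (z : Phase n) (ψ : 𝓢(Config n, ℂ)) :
    JHat hħ (heisenberg ħ z ψ) = heisenberg ħ (sympEquiv (sympJ n) z) (JHat hħ ψ) := by
  ext ξ
  rw [heisenberg_apply, JHat_apply, JHat_apply, pos_sympJ, mom_sympJ,
    ← integral_add_right_eq_self _ (pos z), mul_left_comm]
  congr 1
  rw [← integral_const_mul]
  congr 1
  ext x
  rw [heisenberg_apply, add_sub_cancel_right, ← mul_assoc, ← mul_assoc, ← Complex.exp_add,
    ← Complex.exp_add, ← add_mul, ← add_mul, ← Complex.ofReal_add, ← Complex.ofReal_add]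
  congr 4
  simp only [inner_add_right, inner_sub_left, inner_neg_left]
  rw [real_inner_comm (pos z) ξ, real_inner_comm (mom z) (pos z)]
  ring

theorem MHat_heisenberg (ħ : ℝ) (L : GL (Fin n) ℝ) (m : ℤ) (z : Phase n) (ψ : 𝓢(Config n, ℂ)) :
    MHat L m (heisenberg ħ z ψ) = heisenberg ħ (sympEquiv (sympM L) z) (MHat L m ψ) := by
  ext x
  rw [heisenberg_apply, MHat_apply, MHat_apply, heisenberg_apply, pos_sympM, inner_mom_sympM,
    inner_mom_sympM, map_sub (glEquiv L), ContinuousLinearEquiv.apply_symm_apply]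
  ring

theorem VHat_heisenberg (ħ : ℝ) (P : Matrix (Fin n) (Fin n) ℝ) (hP : P.IsSymm) (z : Phase n)
    (ψ : 𝓢(Config n, ℂ)) :
    VHat ħ P (heisenberg ħ z ψ) = heisenberg ħ (sympEquiv (sympV P hP) z) (VHat ħ P ψ) := by
  ext x
  rw [heisenberg_apply, VHat_apply, VHat_apply, heisenberg_apply, pos_sympV, mom_sympV,
    ← mul_assoc, ← mul_assoc, ← Complex.exp_add, ← Complex.exp_add, ← add_mul, ← add_mul,
    ← Complex.ofReal_add, ← Complex.ofReal_add]
  congr 4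
  have hs : ⟪Matrix.toEuclideanCLM (𝕜 := ℝ) P x, pos z⟫_ℝ =
      ⟪Matrix.toEuclideanCLM (𝕜 := ℝ) P (pos z), x⟫_ℝ := by
    rw [EuclideanSpace.inner_eq_star_dotProduct, EuclideanSpace.inner_eq_star_dotProduct]
    simp only [Matrix.ofLp_toEuclideanCLM, star_trivial]
    rw [Matrix.dotProduct_mulVec, ← Matrix.mulVec_transpose, hP.eq, dotProduct_comm]
  simp only [inner_sub_left, inner_sub_right, map_sub, hs]
  ring

theorem cle_mul_apply {R M : Type*} [Semiring R] [TopologicalSpace M] [AddCommMonoid M] [Module R M]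
    (f g : M ≃L[R] M) (x : M) : (f * g) x = f (g x) := rfl

theorem cle_apply_inv {R M : Type*} [Semiring R] [TopologicalSpace M] [AddCommMonoid M]
    [Module R M] (f : M ≃L[R] M) (x : M) : f (f⁻¹ x) = x := f.apply_symm_apply x

theorem cle_inv_apply {R M : Type*} [Semiring R] [TopologicalSpace M] [AddCommMonoid M]
    [Module R M] (f : M ≃L[R] M) (x : M) : f⁻¹ (f x) = x := f.symm_apply_apply x

/-- The generators of the metaplectic group together with their projections to the symplectic
group: `(Ĵ, J)`, `(M̂_{L,m}, M_L)` and `(V̂_P, V_P)`. -/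
inductive MpGenerator {ħ : ℝ} (hħ : 0 < ħ) :
    (𝓢(Config n, ℂ) ≃L[ℂ] 𝓢(Config n, ℂ)) × Matrix.symplecticGroup (Fin n) ℝ → Prop
  | J : MpGenerator hħ (JHat hħ, sympJ n)
  | M (L : GL (Fin n) ℝ) (m : ℤ) (hm : IsDetArg L m) : MpGenerator hħ (MHat L m, sympM L)
  | V (P : Matrix (Fin n) (Fin n) ℝ) (hP : P.IsSymm) : MpGenerator hħ (VHat ħ P, sympV P hP)

/-- The metaplectic group `Mp(2n, ℝ)`, generated by the operators `Ĵ`, `M̂_{L,m}` and `V̂_P`. Its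
elements are unitary operators on `L²(ℝⁿ)`; they are given here by their restrictions to the dense
invariant subspace `𝓢(ℝⁿ)`, on which they are automorphisms (see `Mp_unitary`). -/
def Mp (n : ℕ) {ħ : ℝ} (hħ : 0 < ħ) : Subgroup (𝓢(Config n, ℂ) ≃L[ℂ] 𝓢(Config n, ℂ)) :=
  Subgroup.closure (Prod.fst '' {g | MpGenerator (n := n) hħ g})

/-- The graph of the projection of the metaplectic group onto the symplectic group. -/
def mpGraph (n : ℕ) {ħ : ℝ} (hħ : 0 < ħ) :
    Subgroup ((𝓢(Config n, ℂ) ≃L[ℂ] 𝓢(Config n, ℂ)) × Matrix.symplecticGroup (Fin n) ℝ) :=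
  Subgroup.closure {g | MpGenerator (n := n) hħ g}

theorem mpGraph_heisenberg {ħ : ℝ} (hħ : 0 < ħ) {g} (hg : g ∈ mpGraph n hħ) :
    ∀ (z : Phase n) (ψ : 𝓢(Config n, ℂ)),
      g.1 (heisenberg ħ z ψ) = heisenberg ħ (sympEquiv g.2 z) (g.1 ψ) := by
  induction hg using Subgroup.closure_induction with
  | mem g hg =>
    intro z ψ
    cases hg with
    | J => exact JHat_heisenberg hħ z ψ
    | M L m hm => exact MHat_heisenberg ħ L m z ψ
    | V P hP => exact VHat_heisenberg ħ P hP z ψ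
  | one => intro z ψ; rw [Prod.snd_one, map_one]; rfl
  | mul g h _ _ hg hh =>
    intro z ψ
    simp only [Prod.fst_mul, Prod.snd_mul, map_mul, cle_mul_apply, hh, hg]
  | inv g _ hg =>
    intro z ψ
    have h := hg ((sympEquiv g.2)⁻¹ z) (g.1⁻¹ ψ)
    rw [cle_apply_inv, cle_apply_inv] at h
    rw [Prod.fst_inv, Prod.snd_inv, map_inv, ← h, cle_inv_apply]

theorem heisenberg_injective {ħ : ℝ} (hħ : 0 < ħ) {z w : Phase n}
    (h : ∀ ψ, heisenberg ħ z ψ = heisenberg ħ w ψ) : z = w := by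
  have bump : ∀ (c : Config n) (r : ℝ), 0 < r → ∃ ψ : 𝓢(Config n, ℂ), ψ c ≠ 0 ∧
      ∀ d, r ≤ dist d c → ψ d = 0 := by
    intro c r hr
    let f : ContDiffBump c := ⟨r / 2, r, by positivity, by linarith⟩
    have h1 : HasCompactSupport (fun x => (f x : ℂ)) :=
      f.hasCompactSupport.comp_left (g := Complex.ofReal) Complex.ofReal_zero
    have h2 : ContDiff ℝ ∞ (fun x => (f x : ℂ)) := Complex.ofRealCLM.contDiff.comp f.contDiff
    refine ⟨h1.toSchwartzMap h2, ?_, fun d hd => ?_⟩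
    · change (f c : ℂ) ≠ 0
      rw [f.one_of_mem_closedBall (Metric.mem_closedBall_self f.rIn_pos.le)]
      simp
    · change (f d : ℂ) = 0
      rw [f.zero_of_le_dist hd]
      simp
  have hpos : pos z = pos w := by
    by_contra hne
    obtain ⟨ψ, h0, h1⟩ := bump 0 (dist (pos z - pos w) 0)
      (dist_pos.2 (sub_ne_zero.2 hne))
    have := congrArg (fun φ : 𝓢(Config n, ℂ) => φ (pos z)) (h ψ)
    simp only [heisenberg_apply, sub_self, h1 _ le_rfl, mul_zero] at this
    exact (mul_ne_zero (Complex.exp_ne_zero _) h0) this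
  refine phase_ext hpos ?_
  have hphase : ∀ x : Config n,
      Complex.exp (((⟪mom z - mom w, x - (2⁻¹ : ℝ) • pos z⟫_ℝ) / ħ : ℝ) * Complex.I) = 1 := by
    intro x
    obtain ⟨ψ, h0⟩ : ∃ ψ : 𝓢(Config n, ℂ), ψ (x - pos z) ≠ 0 := by
      obtain ⟨ψ, h0, _⟩ := bump (x - pos z) 1 one_pos
      exact ⟨ψ, h0⟩
    have := congrArg (fun φ : 𝓢(Config n, ℂ) => φ x) (h ψ)
    simp only [heisenberg_apply, ← hpos] at this
    have h2 := mul_right_cancel₀ h0 this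
    rw [← div_eq_one_iff_eq (Complex.exp_ne_zero _), ← Complex.exp_sub, ← sub_mul,
      ← Complex.ofReal_sub] at h2
    rw [← h2]
    congr 3
    simp only [inner_sub_left, inner_sub_right, inner_smul_right]
    ring
  by_contra hne
  set v := mom z - mom w with hv
  have hv0 : v ≠ 0 := sub_ne_zero.2 hne
  have hvv : 0 < ⟪v, v⟫_ℝ := real_inner_self_pos.2 hv0
  have h1 := hphase ((2⁻¹ : ℝ) • pos z + (ħ / ⟪v, v⟫_ℝ) • v)
  rw [add_sub_cancel_left, inner_smul_right, div_mul_cancel₀ _ hvv.ne', div_self hħ.ne',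
    Complex.exp_eq_one_iff] at h1
  obtain ⟨k, hk⟩ := h1
  have h3 := congrArg Complex.im hk
  simp at h3
  have hp := Real.pi_gt_three
  rcases lt_trichotomy k 0 with hk | rfl | hk
  · have : (k : ℝ) ≤ -1 := by exact_mod_cast (by omega : k ≤ -1)
    nlinarith
  · simp at h3
  · have : (1 : ℝ) ≤ k := by exact_mod_cast (by omega : 1 ≤ k)
    nlinarith

theorem sympEquiv_injective : Function.Injective (sympEquiv (n := n)) := by
  intro s t h
  apply Subtype.ext
  apply (Matrix.toEuclideanCLM (n := Fin n ⊕ Fin n) (𝕜 := ℝ)).injective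
  ext1 z
  exact congrArg (fun g : Phase n ≃L[ℝ] Phase n => g z) h

theorem mpGraph_unique {ħ : ℝ} (hħ : 0 < ħ) {B : 𝓢(Config n, ℂ) ≃L[ℂ] 𝓢(Config n, ℂ)}
    {s t : Matrix.symplecticGroup (Fin n) ℝ} (hs : (B, s) ∈ mpGraph n hħ)
    (ht : (B, t) ∈ mpGraph n hħ) : s = t := by
  apply sympEquiv_injective
  ext1
  funext z
  refine heisenberg_injective hħ fun ψ => ?_
  have h1 := mpGraph_heisenberg hħ hs z (B⁻¹ ψ)
  have h2 := mpGraph_heisenberg hħ ht z (B⁻¹ ψ)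
  simp only [cle_apply_inv] at h1 h2
  rw [← h1, h2]

theorem mpGraph_exists {ħ : ℝ} (hħ : 0 < ħ) (B : Mp n hħ) :
    ∃ s, ((B : 𝓢(Config n, ℂ) ≃L[ℂ] 𝓢(Config n, ℂ)), s) ∈ mpGraph n hħ := by
  have h : (B : 𝓢(Config n, ℂ) ≃L[ℂ] 𝓢(Config n, ℂ)) ∈
      (mpGraph n hħ).map (MonoidHom.fst _ _) := by
    rw [mpGraph, MonoidHom.map_closure]
    exact B.2
  obtain ⟨⟨C, s⟩, hg, rfl : C = B⟩ := h
  exact ⟨s, hg⟩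

/-- The projection `π^Mp : Mp(2n, ℝ) → Sp(2n, ℝ)`: the group homomorphism with `Ĵ ↦ J`,
`M̂_{L,m} ↦ M_L` and `V̂_P ↦ V_P`. -/
def projMp {ħ : ℝ} (hħ : 0 < ħ) : Mp n hħ →* Matrix.symplecticGroup (Fin n) ℝ :=
  MonoidHom.mk' (fun B => (mpGraph_exists hħ B).choose) fun A B =>
    mpGraph_unique hħ (mpGraph_exists hħ (A * B)).choose_spec
      ((mpGraph n hħ).mul_mem (mpGraph_exists hħ A).choose_spec (mpGraph_exists hħ B).choose_spec)

namespace Mp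

/-- `Ĵ` as an element of the metaplectic group. -/
def J (n : ℕ) {ħ : ℝ} (hħ : 0 < ħ) : Mp n hħ :=
  ⟨JHat hħ, Subgroup.subset_closure ⟨_, MpGenerator.J, rfl⟩⟩

/-- `M̂_{L,m}` as an element of the metaplectic group. -/
def M {ħ : ℝ} (hħ : 0 < ħ) (L : GL (Fin n) ℝ) (m : ℤ) (hm : IsDetArg L m) : Mp n hħ :=
  ⟨MHat L m, Subgroup.subset_closure ⟨_, MpGenerator.M L m hm, rfl⟩⟩

/-- `V̂_P` as an element of the metaplectic group. -/
def V {ħ : ℝ} (hħ : 0 < ħ) (P : Matrix (Fin n) (Fin n) ℝ) (hP : P.IsSymm) : Mp n hħ :=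
  ⟨VHat ħ P, Subgroup.subset_closure ⟨_, MpGenerator.V P hP, rfl⟩⟩

end Mp

theorem projMp_J {ħ : ℝ} (hħ : 0 < ħ) : projMp hħ (Mp.J n hħ) = sympJ n :=
  mpGraph_unique hħ (mpGraph_exists hħ _).choose_spec (Subgroup.subset_closure MpGenerator.J)

theorem projMp_M {ħ : ℝ} (hħ : 0 < ħ) (L : GL (Fin n) ℝ) (m : ℤ) (hm : IsDetArg L m) :
    projMp hħ (Mp.M hħ L m hm) = sympM L :=
  mpGraph_unique hħ (mpGraph_exists hħ _).choose_spec
    (Subgroup.subset_closure (MpGenerator.M L m hm))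

theorem projMp_V {ħ : ℝ} (hħ : 0 < ħ) (P : Matrix (Fin n) (Fin n) ℝ) (hP : P.IsSymm) :
    projMp hħ (Mp.V hħ P hP) = sympV P hP :=
  mpGraph_unique hħ (mpGraph_exists hħ _).choose_spec
    (Subgroup.subset_closure (MpGenerator.V P hP))

theorem Mp_heisenberg {ħ : ℝ} (hħ : 0 < ħ) (S : Mp n hħ) (z : Phase n) (ψ : 𝓢(Config n, ℂ)) :
    S.1 (heisenberg ħ z ψ) = heisenberg ħ (sympEquiv (projMp hħ S) z) (S.1 ψ) :=
  mpGraph_heisenberg hħ (mpGraph_exists hħ S).choose_spec z ψ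

/-- The subgroup of the metaplectic group generated by `Ĵ` and the `M̂_{L,m}`. -/
def mpBJ (n : ℕ) {ħ : ℝ} (hħ : 0 < ħ) : Subgroup (Mp n hħ) :=
  Subgroup.closure ({Mp.J n hħ} ∪ {S | ∃ L m hm, S = Mp.M hħ L m hm})

theorem conj_mul_mul (c a b : ℂ) :
    conj (c * a) * (c * b) = ((‖c‖ ^ 2 : ℝ) : ℂ) * (conj a * b) := by
  rw [map_mul, mul_mul_mul_comm, Complex.conj_mul']
  push_cast
  rfl

theorem JHat_unitary {ħ : ℝ} (hħ : 0 < ħ) (ψ φ : 𝓢(Config n, ℂ)) :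
    ∫ x, conj (JHat hħ ψ x) * JHat hħ φ x = ∫ x, conj (ψ x) * φ x := by
  have h1 : ∀ (χ : 𝓢(Config n, ℂ)) (ξ : Config n),
      JHat hħ χ ξ = Complex.exp (((-(n * π / 4) : ℝ) : ℂ) * Complex.I) *
      (((2 * π * ħ) ^ (-(n : ℝ) / 2) : ℝ) : ℂ) * 𝓕 χ ((2 * π * ħ)⁻¹ • ξ) := fun _ _ => rfl
  have h0 : 0 < 2 * π * ħ := by positivity
  simp only [h1, conj_mul_mul]
  rw [integral_const_mul, Measure.integral_comp_smul volume (fun y => conj (𝓕 ψ y) * 𝓕 φ y)]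
  have hP := integral_inner_fourier_fourier ψ φ
  have hP' : ∫ y, conj (𝓕 ψ y) * 𝓕 φ y = ∫ x, conj (ψ x) * φ x := by
    simpa [RCLike.inner_apply, mul_comm] using hP
  rw [hP', norm_mul, Complex.norm_exp_ofReal_mul_I, one_mul, Complex.norm_real,
    Real.norm_of_nonneg (by positivity), ← Real.rpow_natCast, ← Real.rpow_mul h0.le,
    finrank_euclideanSpace_fin, abs_of_nonneg (by positivity), ← inv_pow, inv_inv,
    Complex.real_smul, ← mul_assoc, ← Complex.ofReal_mul, ← Real.rpow_natCast,
    ← Real.rpow_add h0]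
  norm_num

theorem det_glEquiv (L : GL (Fin n) ℝ) :
    ((glEquiv L : Config n ≃L[ℝ] Config n) : Config n →L[ℝ] Config n).det =
      (L : Matrix (Fin n) (Fin n) ℝ).det := by
  change LinearMap.det (Matrix.toLpLin 2 2 (L : Matrix (Fin n) (Fin n) ℝ)) = _
  rw [Matrix.toLpLin_eq_toLin, LinearMap.det_toLin]

theorem MHat_unitary (L : GL (Fin n) ℝ) (m : ℤ) (ψ φ : 𝓢(Config n, ℂ)) :
    ∫ x, conj (MHat L m ψ x) * MHat L m φ x = ∫ x, conj (ψ x) * φ x := by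
  have h : (L : Matrix (Fin n) (Fin n) ℝ).det ≠ 0 :=
    ((Matrix.isUnit_iff_isUnit_det _).1 L.isUnit).ne_zero
  simp only [MHat_apply, conj_mul_mul]
  rw [integral_const_mul, integral_comp_cle (glEquiv L) (fun y => conj (ψ y) * φ y), det_glEquiv,
    ← mul_assoc, ← Complex.ofReal_mul, norm_mul, norm_zpow, Complex.norm_I, one_zpow, one_mul,
    Complex.norm_real, Real.norm_of_nonneg (Real.sqrt_nonneg _), Real.sq_sqrt (abs_nonneg _),
    mul_inv_cancel₀ (abs_ne_zero.2 h)]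
  simp

theorem VHat_unitary (ħ : ℝ) (P : Matrix (Fin n) (Fin n) ℝ) (ψ φ : 𝓢(Config n, ℂ)) :
    ∫ x, conj (VHat ħ P ψ x) * VHat ħ P φ x = ∫ x, conj (ψ x) * φ x := by
  simp only [VHat_apply, conj_mul_mul, Complex.norm_exp_ofReal_mul_I]
  simp

/-- Metaplectic operators preserve the inner product of `L²(ℝⁿ)`. -/
theorem Mp_unitary {ħ : ℝ} (hħ : 0 < ħ) (S : Mp n hħ) (ψ φ : 𝓢(Config n, ℂ)) :
    ∫ x, conj (S.1 ψ x) * S.1 φ x = ∫ x, conj (ψ x) * φ x := by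
  obtain ⟨B, hB⟩ := S
  change ∫ x, conj (B ψ x) * B φ x = _
  induction hB using Subgroup.closure_induction generalizing ψ φ with
  | mem g hg =>
    obtain ⟨g, hg, rfl⟩ := hg
    cases hg with
    | J => exact JHat_unitary hħ ψ φ
    | M L m hm => exact MHat_unitary L m ψ φ
    | V P hP => exact VHat_unitary ħ P ψ φ
  | one => rfl
  | mul g h _ _ hg hh =>
    simp only [cle_mul_apply, hh, hg]
  | inv g _ hg =>
    rw [← hg, cle_apply_inv, cle_apply_inv]

/-- Complex conjugation of Schwartz functions. -/
def conjSchwartz : 𝓢(Config n, ℂ) →L⋆[ℂ] 𝓢(Config n, ℂ) :=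
  mkCLM (fun ψ x => conj (ψ x)) (fun _ _ _ => by simp) (fun _ _ _ => by simp)
    (fun ψ => Complex.conjCLE.contDiff.comp (ψ.smooth ⊤)) <| by
  rintro ⟨k, m⟩
  refine ⟨{(k, m)}, 1, zero_le_one, fun ψ x => ?_⟩
  have h : ‖iteratedFDeriv ℝ m (fun x => conj (ψ x)) x‖ = ‖iteratedFDeriv ℝ m ψ x‖ :=
    Complex.conjLIE.norm_iteratedFDeriv_comp_left (𝕜 := ℝ) ψ x m
  rw [h]
  simpa using ψ.le_seminorm ℂ k m x

@[simp] theorem conjSchwartz_apply (ψ : 𝓢(Config n, ℂ)) (x : Config n) :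
    conjSchwartz ψ x = conj (ψ x) := rfl

/-- The extension of a metaplectic operator to `𝓢'(ℝⁿ)`:
`⟨ŜT, φ⟩ = ⟨T, conj (Ŝ⁻¹ (conj φ))⟩`. -/
def extendDist {ħ : ℝ} {hħ : 0 < ħ} (S : Mp n hħ) : 𝓢'(Config n, ℂ) →L[ℂ] 𝓢'(Config n, ℂ) :=
  PointwiseConvergenceCLM.precomp ℂ
    (conjSchwartz.comp ((S⁻¹).1.toContinuousLinearMap.comp conjSchwartz) :
      𝓢(Config n, ℂ) →L[ℂ] 𝓢(Config n, ℂ))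

theorem extendDist_apply {ħ : ℝ} {hħ : 0 < ħ} (S : Mp n hħ) (T : 𝓢'(Config n, ℂ))
    (φ : 𝓢(Config n, ℂ)) :
    extendDist S T φ = T (conjSchwartz ((S⁻¹).1 (conjSchwartz φ))) := rfl

/-- `extendDist S` extends `S`. -/
theorem extendDist_coe {ħ : ℝ} {hħ : 0 < ħ} (S : Mp n hħ) (ψ : 𝓢(Config n, ℂ)) :
    extendDist S (ψ : 𝓢'(Config n, ℂ)) = (S.1 ψ : 𝓢(Config n, ℂ)) := by
  ext φ
  rw [extendDist_apply, SchwartzMap.coe_apply, SchwartzMap.coe_apply]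
  have h := Mp_unitary hħ S⁻¹ (conjSchwartz φ) (S.1 ψ)
  have e : (S⁻¹).1 (S.1 ψ) = ψ := cle_inv_apply S.1 ψ
  rw [e] at h
  simpa using h

end BornJordan

end

/-!
If linear automorphisms `g` and `h` are contragredient, `⟪g x, h y⟫ = ⟪x, y⟫`, then
`𝓕 (a ∘ g) = |det g|⁻¹ (𝓕 a) ∘ h`. The contragredient of a symplectic `s` is `J s J⁻¹`, so the
symplectic Fourier transform commutes with symplectic maps. As all metaplectic operators intertwine
the Heisenberg operators, `Ŝ Op_BJ(a) Ŝ⁻¹` is, for every `Ŝ` in `Mp(2n, ℝ)` above `s`, the operator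
obtained from `Op_BJ(a)` by replacing `a` by `a ∘ s⁻¹` and `Θ` by `Θ ∘ s⁻¹`. Finally `Θ` is an even
function of `p · x`, and `p · x` is preserved by every `M̂_{L,m}` and changes sign under `Ĵ`.
-/

namespace BornJordan

section FourierTransform

variable {V E : Type*} [NormedAddCommGroup V] [MeasurableSpace V] [BorelSpace V]
  [NormedAddCommGroup E]

section ChangeOfVariables

variable [NormedSpace ℝ V] [FiniteDimensional ℝ V] [NormedSpace ℝ E]

theorem integral_comp_continuousLinearEquiv (μ : Measure V) [μ.IsAddHaarMeasure] (g : V ≃L[ℝ] V)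
    (f : V → E) : ∫ x, f (g x) ∂μ = |(g : V →L[ℝ] V).det|⁻¹ • ∫ x, f x ∂μ := by
  have hdet : |(g : V →L[ℝ] V).det| ≠ 0 := abs_ne_zero.2 g.toLinearEquiv.isUnit_det'.ne_zero
  have h := integral_image_eq_integral_abs_det_fderiv_smul μ MeasurableSet.univ
    (fun x _ => g.hasFDerivWithinAt) g.injective.injOn f
  rw [Set.image_univ, g.surjective.range_eq, setIntegral_univ, setIntegral_univ,
    integral_smul] at h
  rw [h, inv_smul_smul₀ hdet]

end ChangeOfVariables

variable [InnerProductSpace ℝ V] [FiniteDimensional ℝ V] [NormedSpace ℂ E]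

theorem fourier_comp_adjoint (g : V ≃L[ℝ] V) (f : V → E) (η : V) :
    𝓕 (f ∘ g) ((g : V →L[ℝ] V).adjoint η) = |(g : V →L[ℝ] V).det|⁻¹ • 𝓕 f η := by
  rw [Real.fourier_eq, Real.fourier_eq, ← integral_comp_continuousLinearEquiv volume g]
  simp only [ContinuousLinearMap.adjoint_inner_right, Function.comp_apply,
    ContinuousLinearEquiv.coe_coe]

end FourierTransform

variable {n : ℕ}

section DistComp

variable (a : 𝓢'(Phase n, ℂ)) (g h : Phase n ≃L[ℝ] Phase n)

theorem distComp_smul (c : ℂ) : distComp (c • a) g = c • distComp a g := by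
  ext φ
  exact mul_left_comm _ c _

theorem distComp_distComp : distComp (distComp a g) h = distComp a (h.trans g) := by
  have hdet : ((h.trans g : Phase n ≃L[ℝ] Phase n) : Phase n →L[ℝ] Phase n).det =
      (g : Phase n →L[ℝ] Phase n).det * (h : Phase n →L[ℝ] Phase n).det :=
    LinearMap.det_comp _ _
  ext φ
  simp only [distComp_apply, hdet, abs_mul, mul_inv, Complex.ofReal_mul, mul_assoc]
  rw [mul_left_comm]
  rfl

variable {g h}

theorem fourier_distComp (hgh : ∀ x y, ⟪g x, h y⟫_ℝ = ⟪x, y⟫_ℝ) :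
    𝓕 (distComp a g) =
      ((|(g : Phase n →L[ℝ] Phase n).det|⁻¹ : ℝ) : ℂ) • distComp (𝓕 a) h := by
  have hadj (z : Phase n) : (h : Phase n →L[ℝ] Phase n).adjoint z = g.symm z :=
    ext_inner_right ℝ fun y => by
      rw [ContinuousLinearMap.adjoint_inner_left, ← hgh (g.symm z), g.apply_symm_apply]
      rfl
  have fourier_comp_symm (φ : 𝓢(Phase n, ℂ)) :
      compCLMOfContinuousLinearEquiv ℂ g.symm (𝓕 φ) =
        ((|(h : Phase n →L[ℝ] Phase n).det|⁻¹ : ℝ) : ℂ) •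
          𝓕 (compCLMOfContinuousLinearEquiv ℂ h.symm φ) := by
    ext z
    have := fourier_comp_adjoint h (φ ∘ h.symm) z
    rw [Function.comp_assoc, h.symm_comp_self, Function.comp_id, hadj] at this
    exact this
  ext φ
  rw [TemperedDistribution.fourier_apply, distComp_apply, fourier_comp_symm, map_smul]
  rfl

end DistComp

section SymplecticFourier

variable (s : Matrix.symplecticGroup (Fin n) ℝ) {ħ : ℝ} (hħ : 0 < ħ)

/-- Mathlib's `Matrix.J` is `(x, p) ↦ (-p, x)`, the inverse of the `J` in `sympForm`. -/
theorem sympForm_eq_dotProduct (z w : Phase n) :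
    sympForm z w = z.ofLp ⬝ᵥ (Matrix.J (Fin n) ℝ *ᵥ w.ofLp) := by
  simp only [sympForm, EuclideanSpace.inner_eq_star_dotProduct, star_trivial, Matrix.J,
    Matrix.fromBlocks_mulVec, Matrix.dotProduct_block, Sum.elim_comp_inl, Sum.elim_comp_inr,
    Matrix.zero_mulVec, Matrix.neg_mulVec, Matrix.one_mulVec, zero_add, add_zero, dotProduct_neg]
  rw [sub_eq_neg_add, dotProduct_comm (pos w).ofLp]
  rfl

theorem sympForm_sympEquiv (z w : Phase n) :
    sympForm (sympEquiv s z) (sympEquiv s w) = sympForm z w := by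
  have h : (s : Matrix _ _ ℝ)ᵀ * Matrix.J (Fin n) ℝ * (s : Matrix _ _ ℝ) = Matrix.J (Fin n) ℝ :=
    SymplecticGroup.mem_iff'.1 s.2
  rw [sympForm_eq_dotProduct, sympForm_eq_dotProduct, sympEquiv_apply, sympEquiv_apply,
    ← Matrix.vecMul_transpose, ← Matrix.dotProduct_mulVec, Matrix.mulVec_mulVec,
    Matrix.mulVec_mulVec, h]

theorem abs_det_sympEquiv :
    |((sympEquiv s : Phase n ≃L[ℝ] Phase n) : Phase n →L[ℝ] Phase n).det| = 1 := by
  have h : ((sympEquiv s : Phase n ≃L[ℝ] Phase n) : Phase n →L[ℝ] Phase n).det =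
      (s : Matrix (Fin n ⊕ Fin n) (Fin n ⊕ Fin n) ℝ).det := LinearMap.det_toLpLin 2 _
  rw [h, SymplecticGroup.det_eq_one s.2, abs_one]

theorem inner_scaledJ (z w : Phase n) :
    ⟪scaledJ hħ z, w⟫_ℝ = (2 * π * ħ)⁻¹ * sympForm z w := by
  simp only [scaledJ, phaseEquiv_apply, phase_inner, pos_phasePt, mom_phasePt, sympForm,
    real_inner_smul_left]
  rw [real_inner_comm (mom w)]
  ring

theorem inner_sympEquiv_conj_scaledJ (z w : Phase n) :
    ⟪sympEquiv s z, (scaledJ hħ * sympEquiv s * (scaledJ hħ)⁻¹ : Phase n ≃L[ℝ] Phase n) w⟫_ℝ =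
      ⟪z, w⟫_ℝ := by
  rw [cle_mul_apply, cle_mul_apply, real_inner_comm, inner_scaledJ, sympForm_sympEquiv,
    ← inner_scaledJ hħ, cle_apply_inv, real_inner_comm]

theorem sympFourier_distComp (a : 𝓢'(Phase n, ℂ)) :
    sympFourier hħ (distComp a (sympEquiv s)) = distComp (sympFourier hħ a) (sympEquiv s) := by
  have intertwine : (scaledJ hħ).trans (scaledJ hħ * sympEquiv s * (scaledJ hħ)⁻¹) =
      (sympEquiv s).trans (scaledJ hħ) :=
    inv_mul_cancel_right (scaledJ hħ * sympEquiv s) (scaledJ hħ)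
  rw [sympFourier, fourier_distComp a (inner_sympEquiv_conj_scaledJ s hħ), abs_det_sympEquiv,
    inv_one, Complex.ofReal_one, one_smul, distComp_distComp, intertwine, ← distComp_distComp,
    ← distComp_smul, ← sympFourier]

end SymplecticFourier

section Covariance

variable {ħ : ℝ} {hħ : 0 < ħ} (S : Mp n hħ) (ψ φ : 𝓢(Config n, ℂ))

theorem matrixCoeff_eq_heisenberg_apply (z : Phase n) :
    matrixCoeff hħ ψ φ z = (heisenberg ħ z ψ : 𝓢'(Config n, ℂ)) φ := by
  rw [matrixCoeff_apply, SchwartzMap.coe_apply]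
  simp only [smul_eq_mul, mul_comm]

theorem matrixCoeff_inv :
    matrixCoeff hħ ((S⁻¹).1 ψ) (conjSchwartz ((S⁻¹).1 (conjSchwartz φ))) =
      compCLMOfContinuousLinearEquiv ℂ (sympEquiv (projMp hħ S)) (matrixCoeff hħ ψ φ) := by
  have hS : S.1 ((S⁻¹).1 ψ) = ψ := cle_apply_inv S.1 ψ
  ext z
  rw [compCLMOfContinuousLinearEquiv_apply, Function.comp_apply, matrixCoeff_eq_heisenberg_apply,
    ← extendDist_apply, extendDist_coe, Mp_heisenberg, hS, ← matrixCoeff_eq_heisenberg_apply]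

theorem extendDist_opBJ (a : 𝓢'(Phase n, ℂ)) :
    extendDist S (opBJ hħ a ((S⁻¹).1 ψ)) φ =
      (((1 / (2 * π * ħ)) ^ n : ℝ) : ℂ) *
        sympFourier hħ (distComp a (sympEquiv (projMp hħ S)⁻¹))
          (smulLeftCLM ℂ (theta ħ ∘ sympEquiv (projMp hħ S)⁻¹) (matrixCoeff hħ ψ φ)) := by
  rw [extendDist_apply, opBJ_apply, matrixCoeff_inv,
    smulLeftCLM_compCLMOfContinuousLinearEquiv ℂ (theta_growth ħ), sympFourier_distComp,
    distComp_apply, abs_det_sympEquiv, inv_one, Complex.ofReal_one, one_mul, map_inv]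
  rfl

end Covariance

section Theta

theorem theta_sympJ (ħ : ℝ) (z : Phase n) : theta ħ (sympEquiv (sympJ n) z) = theta ħ z := by
  rw [theta, theta, pos_sympJ, mom_sympJ, inner_neg_left, real_inner_comm, neg_div, Real.sinc_neg]

theorem theta_sympM (ħ : ℝ) (L : GL (Fin n) ℝ) (z : Phase n) :
    theta ħ (sympEquiv (sympM L) z) = theta ħ z := by
  rw [theta, theta, inner_mom_sympM, pos_sympM, ContinuousLinearEquiv.apply_symm_apply]

theorem theta_sympEquiv_of_mem_mpBJ {ħ : ℝ} {hħ : 0 < ħ} {S : Mp n hħ} (hS : S ∈ mpBJ n hħ)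
    (z : Phase n) : theta ħ (sympEquiv (projMp hħ S) z) = theta ħ z := by
  induction hS using Subgroup.closure_induction generalizing z with
  | mem S hS =>
    rcases hS with rfl | ⟨L, m, hm, rfl⟩
    · rw [projMp_J, theta_sympJ]
    · rw [projMp_M, theta_sympM]
  | one => rw [map_one, map_one]; rfl
  | mul S T _ _ hS hT => rw [map_mul, map_mul, cle_mul_apply, hS, hT]
  | inv S _ hS => rw [← hS, map_inv, map_inv, cle_apply_inv]

end Theta

end BornJordan

theorem mainTheorem1 (n : ℕ) (ħ : ℝ) (hħ : 0 < ħ) (a : 𝓢'(BornJordan.Phase n, ℂ))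
    (S : BornJordan.Mp n hħ) (hS : S ∈ BornJordan.mpBJ n hħ) :
    (BornJordan.extendDist S) ∘L (BornJordan.opBJ hħ a) ∘L
        ((S⁻¹).1 : 𝓢(BornJordan.Config n, ℂ) →L[ℂ] 𝓢(BornJordan.Config n, ℂ)) =
      BornJordan.opBJ hħ
        (BornJordan.distComp a (BornJordan.sympEquiv (BornJordan.projMp hħ S)⁻¹)) := by
  open BornJordan in
  have hθ : theta ħ ∘ sympEquiv (projMp hħ S)⁻¹ = theta ħ := by
    funext z
    rw [← map_inv, Function.comp_apply, theta_sympEquiv_of_mem_mpBJ ((mpBJ n hħ).inv_mem hS)]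
  ext ψ φ
  rw [ContinuousLinearMap.comp_apply, ContinuousLinearMap.comp_apply]
  exact (extendDist_opBJ S ψ φ a).trans (by rw [hθ, opBJ_apply])
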